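/- Let $(M_1,g_1)$ and $(M_2,g_2)$ be nonempty smooth pseudo-Riemannian manifolds (without boundary) of dimensions $n_1,n_2$, put $n=n_1+n_2$, let $f_i:M_i\to(0,\infty)$ $(i=1,2)$ be smooth, and let $M=M_1\times M_2$ be the doubly warped product with the metric $$g=(f_2\circ\pi_2)^2\,\pi_1^*g_1+(f_1\circ\pi_1)^2\,\pi_2^*g_2,$$ where $\pi_i:M\to M_i$ are the projections. For $\{i,j\}=\{1,2\}$ let $D^i$ be the Levi-Civita connection of $g_i$, and let $\nabla^if_i$, $H^{f_i}$ and $\Delta^if_i=\operatorname{tr}_{g_i}H^{f_i}$ be the gradient, Hessian and Laplacian of $f_i$ with respect to $g_i$. Set $$\mathcal F^i=\frac{n_j}{f_i}H^{f_i},\qquad f_j^{\diamond}=f_j\,\Delta^jf_j+(n_i-1)\,g_j(\nabla^jf_j,\nabla^jf_j).$$ Call a pseudo-Riemannian manifold Ricci symmetric (of class $\mathcal P$) if its Ricci tensor is parallel with respect to its Levi-Civita connection. Suppose that $(M,g)$ is Ricci symmetric. Then, for each $i\in\{1,2\}$ and with $j\neq i$, the factor $(M_i,g_i)$ is Ricci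 symmetric if and only if $$(D^i_X\mathcal F^i)(Y,Z)=\frac{n-2}{f_i^3}\big[g_i(X,Y)\,Z(f_i)+g_i(X,Z)\,Y(f_i)\big]\,(\nabla^jf_j)(f_j)+2\,\frac{f_j^{\diamond}}{f_i^3}\,X(f_i)\,g_i(Y,Z)$$ at every point $(p_1,p_2)\in M_1\times M_2$ and for all tangent vectors $X,Y,Z$ of $M_i$ at $p_i$; here the terms with index $i$ are evaluated at $p_i$ and those with index $j$ at $p_j$. -/

import Mathlib

set_option maxSynthPendingDepth 3

open scoped Manifold ContDiff

noncomputable section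

namespace DoublyWarped

/-! ## Tensor calculus in a coordinate domain

`G : E → E →L[ℝ] E →L[ℝ] ℝ` is the coordinate expression of a pseudo-Riemannian metric. -/

section Local

variable {E : Type*} [NormedAddCommGroup E] [NormedSpace ℝ E]

/-- The Levi-Civita connection of `G` in coordinates (Christoffel symbols): `christoffel G x u v`
is the vector `Γ` determined by
`2 G(Γ, w) = (∂_u G)(v, w) + (∂_v G)(u, w) - (∂_w G)(u, v)` for all `w`. -/
def christoffel (G : E → E →L[ℝ] E →L[ℝ] ℝ) (x : E) : E →L[ℝ] E →L[ℝ] E :=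
  let A : E →L[ℝ] E →L[ℝ] E →L[ℝ] ℝ := fderiv ℝ G x
  let B : E →L[ℝ] E →L[ℝ] E →L[ℝ] ℝ :=
    (ContinuousLinearMap.flipₗᵢ ℝ E E ℝ).toContinuousLinearEquiv.toContinuousLinearMap.comp A.flip
  (ContinuousLinearMap.compL ℝ E (E →L[ℝ] ℝ) E (G x).inverse).comp ((1 / 2 : ℝ) • (A + A.flip - B))

theorem christoffel_apply (G : E → E →L[ℝ] E →L[ℝ] ℝ) (x u v : E) :
    christoffel G x u v = (G x).inverse ((1 / 2 : ℝ) • (fderiv ℝ G x u v + fderiv ℝ G x v u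
      - ((fderiv ℝ G x).flip u).flip v)) :=
  rfl

/-- The curvature operator of `G` in coordinates: for fixed `v, w` the linear map
`u ↦ R(u, v) w`, where `R(U, V) W = D_U D_V W - D_V D_U W - D_[U,V] W`. -/
def curvature (G : E → E →L[ℝ] E →L[ℝ] ℝ) (x v w : E) : E →L[ℝ] E :=
  ((fderiv ℝ (christoffel G) x).flip v).flip w - (fderiv ℝ (christoffel G) x v).flip w
    + (christoffel G x).flip (christoffel G x v w)
    - (christoffel G x v).comp ((christoffel G x).flip w)

theorem curvature_apply (G : E → E →L[ℝ] E →L[ℝ] ℝ) (x u v w : E) :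
    curvature G x v w u =
      fderiv ℝ (christoffel G) x u v w - fderiv ℝ (christoffel G) x v u w
        + christoffel G x u (christoffel G x v w) - christoffel G x v (christoffel G x u w) :=
  rfl

/-- The Ricci tensor of `G` in coordinates: `Ric(v, w)` is the trace of `u ↦ R(u, v) w`. -/
def ricci (G : E → E →L[ℝ] E →L[ℝ] ℝ) (x v w : E) : ℝ :=
  LinearMap.trace ℝ E (curvature G x v w)

/-- The Hessian `H^f(u, v) = u(v(f)) - (D_u v)(f)` in coordinates. -/
def hessian (G : E → E →L[ℝ] E →L[ℝ] ℝ) (f : E → ℝ) (x : E) : E →L[ℝ] E →L[ℝ] ℝ :=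
  fderiv ℝ (fderiv ℝ f) x -
    (ContinuousLinearMap.compL ℝ E E ℝ (fderiv ℝ f x)).comp (christoffel G x)

/-- The Laplacian in coordinates: the trace with respect to `G` of the Hessian. -/
def laplacian (G : E → E →L[ℝ] E →L[ℝ] ℝ) (f : E → ℝ) (x : E) : ℝ :=
  LinearMap.trace ℝ E ((G x).inverse.comp (hessian G f x))

/-- The covariant derivative of a `(0, 2)` tensor field `S` in coordinates:
`(D_u S)(v, w) = u(S(v, w)) - S(D_u v, w) - S(v, D_u w)`, for `v, w` with constant coordinates. -/
def covDeriv (G : E → E →L[ℝ] E →L[ℝ] ℝ) (S : E → E → E → ℝ) (x u v w : E) : ℝ :=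
  fderiv ℝ (fun y ↦ S y v w) x u - S x (christoffel G x u v) w - S x v (christoffel G x u w)

end Local

/-! ## Pseudo-Riemannian manifolds

Manifolds are without boundary and finite-dimensional where these notions are used. A tensor at a
point `p` is computed in the preferred chart at `p`, in which the Levi-Civita connection and the
Ricci tensor are given by the coordinate expressions above. -/

section Manifolds

variable {E : Type*} [NormedAddCommGroup E] [NormedSpace ℝ E]
  {H : Type*} [TopologicalSpace H]
  {M : Type*} [TopologicalSpace M] [ChartedSpace H M]
  {E' : Type*} [NormedAddCommGroup E'] [NormedSpace ℝ E']
  {H' : Type*} [TopologicalSpace H']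
  {M' : Type*} [TopologicalSpace M'] [ChartedSpace H' M']

/-- A smooth pseudo-Riemannian metric on `M`: a smooth symmetric `(0, 2)` tensor field which is
nondegenerate at every point. -/
structure PseudoRiemannianMetric (I : ModelWithCorners ℝ E H) (M : Type*) [TopologicalSpace M]
    [ChartedSpace H M] [IsManifold I ∞ M] where
  /-- the scalar product on each tangent space -/
  inner (p : M) : TangentSpace I p →L[ℝ] TangentSpace I p →L[ℝ] ℝ
  symm (p : M) (v w : TangentSpace I p) : inner p v w = inner p w v
  nondegenerate (p : M) (v : TangentSpace I p) (hv : ∀ w, inner p v w = 0) : v = 0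
  contMDiff : ContMDiff I (I.prod 𝓘(ℝ, E →L[ℝ] E →L[ℝ] ℝ)) ∞
    (fun p ↦ Bundle.TotalSpace.mk' (E →L[ℝ] E →L[ℝ] ℝ)
      (E := fun p : M ↦ TangentSpace I p →L[ℝ] TangentSpace I p →L[ℝ] ℝ) p (inner p))

/-- The pullback `F^* T` of a `(0, 2)` tensor field. -/
def pullback (I : ModelWithCorners ℝ E H) (I' : ModelWithCorners ℝ E' H') (F : M → M')
    (T : ∀ p : M', TangentSpace I' p →L[ℝ] TangentSpace I' p →L[ℝ] ℝ) (p : M) :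
    TangentSpace I p →L[ℝ] TangentSpace I p →L[ℝ] ℝ :=
  (ContinuousLinearMap.precomp ℝ (mfderiv I I' F p)).comp ((T (F p)).comp (mfderiv I I' F p))

@[simp]
theorem pullback_apply (I : ModelWithCorners ℝ E H) (I' : ModelWithCorners ℝ E' H') (F : M → M')
    (T : ∀ p : M', TangentSpace I' p →L[ℝ] TangentSpace I' p →L[ℝ] ℝ) (p : M)
    (v w : TangentSpace I p) :
    pullback I I' F T p v w = T (F p) (mfderiv I I' F p v) (mfderiv I I' F p w) :=
  rfl

theorem contMDiff_pullback {I : ModelWithCorners ℝ E H} {I' : ModelWithCorners ℝ E' H'}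
    [IsManifold I ∞ M] [IsManifold I' ∞ M'] {F : M → M'} (hF : ContMDiff I I' ∞ F)
    {T : ∀ p : M', TangentSpace I' p →L[ℝ] TangentSpace I' p →L[ℝ] ℝ}
    (hT : ContMDiff I' (I'.prod 𝓘(ℝ, E' →L[ℝ] E' →L[ℝ] ℝ)) ∞
      (fun p ↦ Bundle.TotalSpace.mk' (E' →L[ℝ] E' →L[ℝ] ℝ)
        (E := fun p : M' ↦ TangentSpace I' p →L[ℝ] TangentSpace I' p →L[ℝ] ℝ) p (T p))) :
    ContMDiff I (I.prod 𝓘(ℝ, E →L[ℝ] E →L[ℝ] ℝ)) ∞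
      (fun p ↦ Bundle.TotalSpace.mk' (E →L[ℝ] E →L[ℝ] ℝ)
        (E := fun p : M ↦ TangentSpace I p →L[ℝ] TangentSpace I p →L[ℝ] ℝ) p
        (pullback I I' F T p)) := by
  intro x₀
  have : IsManifold I 1 M := IsManifold.of_le (n := ∞) (by simp)
  have : IsManifold I' 1 M' := IsManifold.of_le (n := ∞) (by simp)
  have h1 := (hT (F x₀))
  rw [contMDiffAt_hom_bundle] at h1 ⊢
  refine ⟨contMDiffAt_id, ?_⟩
  have h2 := h1.2.comp x₀ (hF x₀)
  have h3 : ContMDiffAt I 𝓘(ℝ, E →L[ℝ] E') ∞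
      (inTangentCoordinates I I' id F (mfderiv I I' F) x₀) x₀ :=
    (hF x₀).mfderiv_const (by simp)
  have hΦ : ContDiff ℝ ∞ (fun z : (E' →L[ℝ] E' →L[ℝ] ℝ) × (E →L[ℝ] E') ↦
      ((ContinuousLinearMap.compL ℝ E E' ℝ).flip z.2).comp (z.1.comp z.2)) :=
    ((ContinuousLinearMap.contDiff _).comp contDiff_snd).clm_comp (contDiff_fst.clm_comp contDiff_snd)
  have h4 := hΦ.contMDiff.contMDiffAt.comp x₀ (h2.prodMk_space h3)
  refine h4.congr_of_eventuallyEq ?_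
  have e1 : ∀ᶠ x in nhds x₀, x ∈ (trivializationAt E (TangentSpace I) x₀).baseSet :=
    (trivializationAt E (TangentSpace I) x₀).open_baseSet.mem_nhds
      (FiberBundle.mem_baseSet_trivializationAt' x₀)
  have e2 : ∀ᶠ x in nhds x₀, F x ∈ (trivializationAt E' (TangentSpace I') (F x₀)).baseSet :=
    hF.continuous.continuousAt.eventually ((trivializationAt E' (TangentSpace I')
      (F x₀)).open_baseSet.mem_nhds (FiberBundle.mem_baseSet_trivializationAt' (F x₀)))
  filter_upwards [e1, e2] with x hx hx'
  ext v w
  simp only [Function.comp_apply]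
  rw [inCoordinates_apply_eq₂ hx hx (Set.mem_univ _)]
  change _ = ContinuousLinearMap.inCoordinates E' (TangentSpace I') (E' →L[ℝ] ℝ)
    (fun b => TangentSpace I' b →L[ℝ] ℝ) (F x₀) (F x) (F x₀) (F x) (T (F x))
    (inTangentCoordinates I I' id F (mfderiv I I' F) x₀ x v)
    (inTangentCoordinates I I' id F (mfderiv I I' F) x₀ x w)
  rw [inCoordinates_apply_eq₂ hx' hx' (Set.mem_univ _)]
  have e (u : E) : (trivializationAt E' (TangentSpace I') (F x₀)).symm (F x)
      (inTangentCoordinates I I' id F (mfderiv I I' F) x₀ x u) =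
      mfderiv I I' F x ((trivializationAt E (TangentSpace I) x₀).symm x u) := by
    have h := Bundle.Trivialization.symmL_continuousLinearMapAt (R := ℝ)
      (trivializationAt E' (TangentSpace I') (F x₀)) hx'
      (mfderiv I I' F x ((trivializationAt E (TangentSpace I) x₀).symmL ℝ x u))
    rw [Bundle.Trivialization.symmL_apply _ hx', Bundle.Trivialization.symmL_apply _ hx] at h
    rw [← h, ← Bundle.Trivialization.symmL_apply (R := ℝ) _ hx]
    rfl
  rw [e, e]
  rfl

namespace PseudoRiemannianMetric

variable {I : ModelWithCorners ℝ E H} [IsManifold I ∞ M]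

/-- The coordinate expression of `g` in the preferred chart at `p`. -/
def inChart (g : PseudoRiemannianMetric I M) (p : M) : E → E →L[ℝ] E →L[ℝ] ℝ :=
  pullback 𝓘(ℝ, E) I (extChartAt I p).symm g.inner

/-- The gradient of a function: `g(∇f, v) = v(f)` for every tangent vector `v`. -/
def grad (g : PseudoRiemannianMetric I M) (f : M → ℝ) (p : M) : TangentSpace I p :=
  (g.inner p).inverse (mvfderiv I f p)

/-- The Laplacian of a function. -/
def laplacian (g : PseudoRiemannianMetric I M) (f : M → ℝ) (p : M) : ℝ :=
  DoublyWarped.laplacian (g.inChart p) (f ∘ (extChartAt I p).symm) (extChartAt I p p)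

/-- The covariant derivative at `p` of a `(0, 2)` tensor field whose coordinate expression in the
preferred chart at `p` is `S`. The value does not depend on the chart. -/
def covDerivAt (g : PseudoRiemannianMetric I M) (p : M) (S : E → E → E → ℝ)
    (X Y Z : TangentSpace I p) : ℝ :=
  covDeriv (g.inChart p) S (extChartAt I p p) (mfderiv I 𝓘(ℝ, E) (extChartAt I p) p X)
    (mfderiv I 𝓘(ℝ, E) (extChartAt I p) p Y) (mfderiv I 𝓘(ℝ, E) (extChartAt I p) p Z)

/-- `(D_X Ric)(Y, Z)`. -/
def covDerivRicci (g : PseudoRiemannianMetric I M) (p : M) (X Y Z : TangentSpace I p) : ℝ :=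
  g.covDerivAt p (ricci (g.inChart p)) X Y Z

/-- `g` is Ricci symmetric (class `𝒫`): its Ricci tensor is parallel. -/
def IsRicciSymmetric (g : PseudoRiemannianMetric I M) : Prop :=
  ∀ (p : M) (X Y Z : TangentSpace I p), g.covDerivRicci p X Y Z = 0

/-- `(D_X 𝓕)(Y, Z)` for the tensor `𝓕 = (m / f) H^f`. -/
def covDerivF (g : PseudoRiemannianMetric I M) (m : ℕ) (f : M → ℝ) (p : M)
    (X Y Z : TangentSpace I p) : ℝ :=
  g.covDerivAt p (fun x v w ↦ m / f ((extChartAt I p).symm x) *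
    hessian (g.inChart p) (f ∘ (extChartAt I p).symm) x v w) X Y Z

/-- `f^◇ = f Δf + (m - 1) g(∇f, ∇f)`, where `m` is the dimension of the other factor. -/
def diamond (g : PseudoRiemannianMetric I M) (m : ℕ) (f : M → ℝ) (p : M) : ℝ :=
  f p * g.laplacian f p + ((m : ℝ) - 1) * g.inner p (g.grad f p) (g.grad f p)

end PseudoRiemannianMetric

/-- The doubly warped product metric `(f₂ ∘ π₂)² π₁^* g₁ + (f₁ ∘ π₁)² π₂^* g₂` on `M₁ × M₂`. -/
def doublyWarpedProduct {I : ModelWithCorners ℝ E H} {I' : ModelWithCorners ℝ E' H'}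
    [IsManifold I ∞ M] [IsManifold I' ∞ M']
    (g₁ : PseudoRiemannianMetric I M) (g₂ : PseudoRiemannianMetric I' M')
    (f₁ : M → ℝ) (f₂ : M' → ℝ) (hf₁ : ContMDiff I 𝓘(ℝ) ∞ f₁) (hf₂ : ContMDiff I' 𝓘(ℝ) ∞ f₂)
    (hpos₁ : ∀ p, 0 < f₁ p) (hpos₂ : ∀ p, 0 < f₂ p) :
    PseudoRiemannianMetric (I.prod I') (M × M') where
  inner p := f₂ p.2 ^ 2 • pullback (I.prod I') I Prod.fst g₁.inner p +
    f₁ p.1 ^ 2 • pullback (I.prod I') I' Prod.snd g₂.inner p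
  symm p v w := by
    simp only [add_apply, smul_apply, pullback_apply]
    rw [g₁.symm, g₂.symm]
  nondegenerate p v hv := by
    have key (w : TangentSpace (I.prod I') p) :
        f₂ p.2 ^ 2 * g₁.inner p.1 v.1 w.1 + f₁ p.1 ^ 2 * g₂.inner p.2 v.2 w.2 = 0 := by
      have := hv w
      simp only [add_apply, smul_apply, pullback_apply,
        mfderiv_fst, mfderiv_snd, smul_eq_mul] at this
      exact this
    have h1 : v.1 = 0 := g₁.nondegenerate p.1 v.1 fun w ↦ by
      have := key (w, 0)
      have h0 : g₂.inner p.2 v.2 (0 : TangentSpace I' p.2) = 0 := map_zero _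
      erw [h0] at this
      simpa [(hpos₂ p.2).ne'] using this
    have h2 : v.2 = 0 := g₂.nondegenerate p.2 v.2 fun w ↦ by
      have := key (0, w)
      have h0 : g₁.inner p.1 v.1 (0 : TangentSpace I p.1) = 0 := map_zero _
      erw [h0] at this
      simpa [(hpos₁ p.1).ne'] using this
    exact Prod.ext h1 h2
  contMDiff :=
    (((hf₂.comp contMDiff_snd).pow 2).smul_section (contMDiff_pullback contMDiff_fst g₁.contMDiff)).add_section
      (((hf₁.comp contMDiff_fst).pow 2).smul_section (contMDiff_pullback contMDiff_snd g₂.contMDiff))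

end Manifolds

end DoublyWarped

end

/-! The proof computes the component of the parallelism equation tangent to one factor. For vectors
tangent to `M₁` (similarly for `M₂`), `(∇_X Ric)(Y, Z)` equals `(D¹_X Ric₁)(Y, Z) - (D¹_X 𝓕¹)(Y, Z)`
plus the right-hand side of the asserted equation. If the left side vanishes, parallelism of `Ric₁`
is therefore equivalent to that equation. Other components of the hypothesis are not needed.

The formula (`IsWarpedOn.covDeriv_ricci`) is proved in coordinates, with `f` and `h` the warping
functions of the first and second factors. The Koszul formula gives `∇_a b = D_a b - (h / f²) g₁(a,
b) ∇h` for `a, b` tangent to the first factor, and only logarithmic derivatives of `f, h` for mixed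
arguments. Taking traces of the diagonal blocks of the curvature operator yields `Ric(Y, Z) = Ric₁ -
𝓕 - (h^◇ / f²) g₁` on the first factor and `(n - 2) Y(f) W(h) / (f h)` for mixed arguments.
Differentiating `f⁻²` produces the `h^◇` term of the theorem. The component of `∇_X Y` along the
second factor, paired with the mixed Ricci tensor, produces the `n - 2` terms; everything else is
covariant differentiation on the first factor. -/

noncomputable section

namespace DoublyWarped

/-! ### Levi-Civita calculus of a metric on an open set of a vector space. -/

section LocalTheory

variable {E : Type*} [NormedAddCommGroup E] [NormedSpace ℝ E]

/-- `G` is the coordinate expression of a smooth pseudo-Riemannian metric on the open set `U`. -/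
structure IsMetricOn (G : E → E →L[ℝ] E →L[ℝ] ℝ) (U : Set E) : Prop where
  isOpen : IsOpen U
  contDiffOn : ContDiffOn ℝ ∞ G U
  symm : ∀ x ∈ U, ∀ v w, G x v w = G x w v
  nondegenerate : ∀ x ∈ U, ∀ v, (∀ w, G x v w = 0) → v = 0

/-- The gradient of `f` in coordinates. -/
def coordGrad (G : E → E →L[ℝ] E →L[ℝ] ℝ) (f : E → ℝ) (x : E) : E :=
  (G x).inverse (fderiv ℝ f x)

/-- `ricci` is a bare function of its arguments. Its bilinearity is needed to expand it on
Christoffel vectors, which have components in both factors. -/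
theorem ricci_add_left (G : E → E →L[ℝ] E →L[ℝ] ℝ) (x v v' w : E) :
    ricci G x (v + v') w = ricci G x v w + ricci G x v' w := by
  have : curvature G x (v + v') w = curvature G x v w + curvature G x v' w := by
    ext u
    simp only [curvature_apply, add_apply, map_add]
    abel
  simp only [ricci, this, ContinuousLinearMap.toLinearMap_add, map_add]

theorem ricci_smul_left (G : E → E →L[ℝ] E →L[ℝ] ℝ) (x v w : E) (c : ℝ) :
    ricci G x (c • v) w = c * ricci G x v w := by
  have : curvature G x (c • v) w = c • curvature G x v w := by
    ext u
    simp only [curvature_apply, smul_apply, map_smul, smul_sub, smul_add]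
  simp only [ricci, this, ContinuousLinearMap.toLinearMap_smul, map_smul, smul_eq_mul]

theorem ricci_add_right (G : E → E →L[ℝ] E →L[ℝ] ℝ) (x v w w' : E) :
    ricci G x v (w + w') = ricci G x v w + ricci G x v w' := by
  have : curvature G x v (w + w') = curvature G x v w + curvature G x v w' := by
    ext u
    simp only [curvature_apply, add_apply, map_add]
    abel
  simp only [ricci, this, ContinuousLinearMap.toLinearMap_add, map_add]

theorem ricci_smul_right (G : E → E →L[ℝ] E →L[ℝ] ℝ) (x v w : E) (c : ℝ) :
    ricci G x v (c • w) = c * ricci G x v w := by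
  have : curvature G x v (c • w) = c • curvature G x v w := by
    ext u
    simp only [curvature_apply, smul_apply, map_smul, smul_sub, smul_add]
  simp only [ricci, this, ContinuousLinearMap.toLinearMap_smul, map_smul, smul_eq_mul]

namespace IsMetricOn

variable {G : E → E →L[ℝ] E →L[ℝ] ℝ} {U : Set E} {x : E}

theorem contDiffAt (hG : IsMetricOn G U) (hx : x ∈ U) : ContDiffAt ℝ ∞ G x :=
  hG.contDiffOn.contDiffAt (hG.isOpen.mem_nhds hx)

theorem differentiableAt (hG : IsMetricOn G U) (hx : x ∈ U) : DifferentiableAt ℝ G x :=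
  (hG.contDiffAt hx).differentiableAt (by simp)

theorem hasFDerivAt_apply (hG : IsMetricOn G U) (hx : x ∈ U) (v w : E) :
    HasFDerivAt (fun y ↦ G y v w) (((fderiv ℝ G x).flip v).flip w) x := by
  have h := ((hG.differentiableAt hx).hasFDerivAt.clm_apply (hasFDerivAt_const v x)).clm_apply
    (hasFDerivAt_const w x)
  refine h.congr_fderiv ?_
  ext u
  simp

theorem fderiv_symm (hG : IsMetricOn G U) (hx : x ∈ U) (u v w : E) :
    fderiv ℝ G x u v w = fderiv ℝ G x u w v := by
  have h1 := (hG.hasFDerivAt_apply hx v w).fderiv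
  have h2 := (hG.hasFDerivAt_apply hx w v).fderiv
  have h3 : (fun y ↦ G y v w) =ᶠ[nhds x] fun y ↦ G y w v :=
    Filter.eventually_of_mem (hG.isOpen.mem_nhds hx) fun y hy ↦ hG.symm y hy v w
  rw [h3.fderiv_eq, h2] at h1
  exact (DFunLike.congr_fun h1 u).symm

variable [FiniteDimensional ℝ E]

/-- Nondegeneracy is injectivity of `v ↦ G(v, ·)`, and in finite dimension `E` and its dual have
equal dimension. Hence `(G x).inverse` is a true inverse and not the default value zero. -/
theorem isInvertible (hG : IsMetricOn G U) (hx : x ∈ U) : (G x).IsInvertible := by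
  have hinj : Function.Injective (G x : E →ₗ[ℝ] E →L[ℝ] ℝ) := by
    refine (injective_iff_map_eq_zero _).2 fun v hv ↦ hG.nondegenerate x hx v fun w ↦ ?_
    exact DFunLike.congr_fun hv w
  have hdim : Module.finrank ℝ E = Module.finrank ℝ (E →L[ℝ] ℝ) := by
    rw [← LinearEquiv.finrank_eq (LinearMap.toContinuousLinearMap (𝕜 := ℝ) (E := E) (F' := ℝ))]
    exact Subspace.dual_finrank_eq.symm
  exact ⟨(LinearEquiv.ofInjectiveOfFinrankEq _ hinj hdim).toContinuousLinearEquiv, by ext; rfl⟩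

theorem apply_inverse (hG : IsMetricOn G U) (hx : x ∈ U) (α : E →L[ℝ] ℝ) :
    G x ((G x).inverse α) = α :=
  (hG.isInvertible hx).self_apply_inverse α

theorem apply_coordGrad (hG : IsMetricOn G U) (hx : x ∈ U) (f : E → ℝ) (w : E) :
    G x (coordGrad G f x) w = fderiv ℝ f x w := by
  rw [coordGrad, hG.apply_inverse hx]

theorem apply_coordGrad' (hG : IsMetricOn G U) (hx : x ∈ U) (f : E → ℝ) (w : E) :
    G x w (coordGrad G f x) = fderiv ℝ f x w := by
  rw [hG.symm x hx, hG.apply_coordGrad hx]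

theorem ext_inner (hG : IsMetricOn G U) (hx : x ∈ U) {u v : E} (h : ∀ w, G x u w = G x v w) :
    u = v :=
  (hG.isInvertible hx).injective (by ext w; exact h w)

theorem koszul (hG : IsMetricOn G U) (hx : x ∈ U) (u v w : E) :
    G x (christoffel G x u v) w =
      (1 / 2) * (fderiv ℝ G x u v w + fderiv ℝ G x v u w - fderiv ℝ G x w u v) := by
  rw [christoffel_apply, hG.apply_inverse hx]
  simp

theorem christoffel_eq (hG : IsMetricOn G U) (hx : x ∈ U) {u v c : E}
    (h : ∀ w, G x c w =
      (1 / 2) * (fderiv ℝ G x u v w + fderiv ℝ G x v u w - fderiv ℝ G x w u v)) :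
    christoffel G x u v = c :=
  hG.ext_inner hx fun w ↦ by rw [hG.koszul hx, h]

theorem christoffel_symm (hG : IsMetricOn G U) (hx : x ∈ U) (u v : E) :
    christoffel G x u v = christoffel G x v u :=
  hG.christoffel_eq hx fun w ↦ by
    rw [hG.koszul hx, hG.fderiv_symm hx w u v]; ring

/-- The Levi-Civita connection is compatible with the metric. -/
theorem fderiv_eq (hG : IsMetricOn G U) (hx : x ∈ U) (u v w : E) :
    fderiv ℝ G x u v w = G x (christoffel G x u v) w + G x v (christoffel G x u w) := by
  rw [hG.symm x hx v, hG.koszul hx, hG.koszul hx, hG.fderiv_symm hx u w v,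
    hG.fderiv_symm hx w u v]
  ring

theorem contDiffAt_inverse (hG : IsMetricOn G U) (hx : x ∈ U) :
    ContDiffAt ℝ ∞ (fun y ↦ (G y).inverse) x :=
  (hG.isInvertible hx).contDiffAt_map_inverse.comp x (hG.contDiffAt hx)

theorem contDiffAt_christoffel (hG : IsMetricOn G U) (hx : x ∈ U) :
    ContDiffAt ℝ ∞ (christoffel G) x := by
  have hA : ContDiffAt ℝ ∞ (fderiv ℝ G) x := (hG.contDiffAt hx).fderiv_right (by simp)
  have hA' : ContDiffAt ℝ ∞ (fun y ↦ (fderiv ℝ G y).flip) x :=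
    (ContinuousLinearMap.flipₗᵢ ℝ E E (E →L[ℝ] ℝ)).toContinuousLinearEquiv.contDiff.contDiffAt.comp
      x hA
  unfold christoffel
  exact ((ContinuousLinearMap.contDiff _).contDiffAt.comp x (hG.contDiffAt_inverse hx)).clm_comp
    (((hA.add hA').sub (contDiffAt_const.clm_comp hA')).const_smul _)

theorem hasFDerivAt_christoffel_apply (hG : IsMetricOn G U) (hx : x ∈ U) (v w : E) :
    HasFDerivAt (fun y ↦ christoffel G y v w) (((fderiv ℝ (christoffel G) x).flip v).flip w) x := by
  have h := ((((hG.contDiffAt_christoffel hx).differentiableAt (by simp)).hasFDerivAt.clm_apply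
    (hasFDerivAt_const v x))).clm_apply (hasFDerivAt_const w x)
  refine h.congr_fderiv ?_
  ext u
  simp

theorem contDiffAt_curvature (hG : IsMetricOn G U) (hx : x ∈ U) (v w : E) :
    ContDiffAt ℝ ∞ (fun y ↦ curvature G y v w) x := by
  have hΓ := hG.contDiffAt_christoffel hx
  have hD : ContDiffAt ℝ ∞ (fderiv ℝ (christoffel G)) x := hΓ.fderiv_right (by simp)
  have hD' : ContDiffAt ℝ ∞ (fun y ↦ (fderiv ℝ (christoffel G) y).flip v) x :=
    ((ContinuousLinearMap.flipₗᵢ ℝ E E (E →L[ℝ] E)).toContinuousLinearEquiv.contDiff.contDiffAt.comp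
      x hD).clm_apply contDiffAt_const
  have hflip : ContDiff ℝ ∞ (fun T : E →L[ℝ] E →L[ℝ] E ↦ T.flip) :=
    (ContinuousLinearMap.flipₗᵢ ℝ E E E).toContinuousLinearEquiv.contDiff
  have hΓ' := hflip.contDiffAt.comp x hΓ
  exact ((((hflip.contDiffAt.comp x hD').clm_apply contDiffAt_const).sub
    ((hflip.contDiffAt.comp x (hD.clm_apply contDiffAt_const)).clm_apply contDiffAt_const)).add
      (hΓ'.clm_apply ((hΓ.clm_apply contDiffAt_const).clm_apply contDiffAt_const))).sub
    ((hΓ.clm_apply contDiffAt_const).clm_comp (hΓ'.clm_apply contDiffAt_const))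

theorem differentiableAt_ricci (hG : IsMetricOn G U) (hx : x ∈ U) (v w : E) :
    DifferentiableAt ℝ (fun y ↦ ricci G y v w) x := by
  have h := (hG.contDiffAt_curvature hx v w).differentiableAt (by simp)
  exact ((LinearMap.trace ℝ E ∘ₗ ContinuousLinearMap.coeLM ℝ).toContinuousLinearMap
    |>.differentiableAt).comp x h

theorem contDiffAt_hessian (hG : IsMetricOn G U) (hx : x ∈ U) {f : E → ℝ}
    (hf : ContDiffAt ℝ ∞ f x) : ContDiffAt ℝ ∞ (hessian G f) x := by
  have h1 : ContDiffAt ℝ ∞ (fderiv ℝ f) x := hf.fderiv_right (by simp)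
  exact (h1.fderiv_right (by simp)).sub
    (((ContinuousLinearMap.contDiff _).contDiffAt.comp x h1).clm_comp (hG.contDiffAt_christoffel hx))

theorem contDiffAt_coordGrad (hG : IsMetricOn G U) (hx : x ∈ U) {f : E → ℝ}
    (hf : ContDiffAt ℝ ∞ f x) : ContDiffAt ℝ ∞ (coordGrad G f) x :=
  (hG.contDiffAt_inverse hx).clm_apply (hf.fderiv_right (by simp))

/-- The covariant derivative of the gradient is the Hessian. -/
theorem covDeriv_coordGrad (hG : IsMetricOn G U) (hx : x ∈ U) {f : E → ℝ}
    (hf : ContDiffAt ℝ ∞ f x) (u : E) :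
    fderiv ℝ (coordGrad G f) x u + christoffel G x u (coordGrad G f x) =
      (G x).inverse (hessian G f x u) := by
  refine hG.ext_inner hx fun w ↦ ?_
  rw [hG.apply_inverse hx]
  have hf1 : ContDiffAt ℝ ∞ (fderiv ℝ f) x := hf.fderiv_right (by simp)
  have h1 := ((hG.differentiableAt hx).hasFDerivAt.clm_apply
    ((hG.contDiffAt_coordGrad hx hf).differentiableAt (by simp)).hasFDerivAt).clm_apply
      (hasFDerivAt_const w x)
  have h2 := ((hf1.differentiableAt (by simp)).hasFDerivAt).clm_apply (hasFDerivAt_const w x)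
  -- Differentiate the defining identity `G(∇f, w) = df(w)` with `w` constant in coordinates; metric
  -- compatibility then converts the derivative of `G` into Christoffel terms.
  have h3 : (fun y ↦ G y (coordGrad G f y) w) =ᶠ[nhds x] fun y ↦ fderiv ℝ f y w :=
    Filter.eventually_of_mem (hG.isOpen.mem_nhds hx) fun y hy ↦ hG.apply_coordGrad hy f w
  have h4 := DFunLike.congr_fun ((h1.congr_of_eventuallyEq h3.symm).unique h2) u
  simp only [ContinuousLinearMap.comp_zero, zero_add, ContinuousLinearMap.flip_apply, add_apply,
    ContinuousLinearMap.comp_apply] at h4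
  have h5 : hessian G f x u w =
      fderiv ℝ (fderiv ℝ f) x u w - fderiv ℝ f x (christoffel G x u w) := rfl
  rw [h5, ← h4, map_add, add_apply, ← hG.apply_coordGrad hx, hG.fderiv_eq hx]
  ring

/-- The Laplacian as the divergence of the gradient, the form in which it comes out of the curvature
trace over the other factor. -/
theorem trace_hessian (hG : IsMetricOn G U) (hx : x ∈ U) {f : E → ℝ} (hf : ContDiffAt ℝ ∞ f x) :
    LinearMap.trace ℝ E ((fderiv ℝ (coordGrad G f) x +
      (christoffel G x).flip (coordGrad G f x) : E →L[ℝ] E) : E →ₗ[ℝ] E) = laplacian G f x := by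
  rw [laplacian]
  congr 2
  ext u
  exact hG.covDeriv_coordGrad hx hf u

end IsMetricOn

end LocalTheory

end DoublyWarped

/-! ### Direct sums and the Levi-Civita connection of a doubly warped metric. -/

namespace DoublyWarped

/-- A decomposition of `E` as a direct sum of `E₁` and `E₂`. -/
structure Splitting (E E₁ E₂ : Type*) [NormedAddCommGroup E] [NormedSpace ℝ E]
    [NormedAddCommGroup E₁] [NormedSpace ℝ E₁] [NormedAddCommGroup E₂] [NormedSpace ℝ E₂] where
  /-- the first projection -/
  π₁ : E →L[ℝ] E₁
  /-- the second projection -/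
  π₂ : E →L[ℝ] E₂
  /-- the first inclusion -/
  ι₁ : E₁ →L[ℝ] E
  /-- the second inclusion -/
  ι₂ : E₂ →L[ℝ] E
  π₁_ι₁ (v : E₁) : π₁ (ι₁ v) = v
  π₁_ι₂ (v : E₂) : π₁ (ι₂ v) = 0
  π₂_ι₁ (v : E₁) : π₂ (ι₁ v) = 0
  π₂_ι₂ (v : E₂) : π₂ (ι₂ v) = v
  ι_add_ι (v : E) : ι₁ (π₁ v) + ι₂ (π₂ v) = v

section LocalWarped

variable {E E₁ E₂ : Type*} [NormedAddCommGroup E] [NormedSpace ℝ E]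
  [NormedAddCommGroup E₁] [NormedSpace ℝ E₁] [NormedAddCommGroup E₂] [NormedSpace ℝ E₂]

namespace Splitting

attribute [simp] π₁_ι₁ π₁_ι₂ π₂_ι₁ π₂_ι₂ ι_add_ι

/-- The splitting with the two summands exchanged. -/
def swap (S : Splitting E E₁ E₂) : Splitting E E₂ E₁ where
  π₁ := S.π₂
  π₂ := S.π₁
  ι₁ := S.ι₂
  ι₂ := S.ι₁
  π₁_ι₁ := S.π₂_ι₂
  π₁_ι₂ := S.π₂_ι₁
  π₂_ι₁ := S.π₁_ι₂
  π₂_ι₂ := S.π₁_ι₁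
  ι_add_ι v := by rw [add_comm, S.ι_add_ι]

/-- The splitting of a product. -/
def prod (E₁ E₂ : Type*) [NormedAddCommGroup E₁] [NormedSpace ℝ E₁] [NormedAddCommGroup E₂]
    [NormedSpace ℝ E₂] : Splitting (E₁ × E₂) E₁ E₂ where
  π₁ := .fst ℝ E₁ E₂
  π₂ := .snd ℝ E₁ E₂
  ι₁ := .inl ℝ E₁ E₂
  ι₂ := .inr ℝ E₁ E₂
  π₁_ι₁ _ := rfl
  π₁_ι₂ _ := rfl
  π₂_ι₁ _ := rfl
  π₂_ι₂ _ := rfl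
  ι_add_ι v := by simp

/-- Write `T = T ι₁ π₁ + T ι₂ π₂` and use cyclicity of the trace. Only the diagonal blocks of the
curvature operator thus matter for Ricci. -/
theorem trace_eq [FiniteDimensional ℝ E] [FiniteDimensional ℝ E₁] [FiniteDimensional ℝ E₂]
    (S : Splitting E E₁ E₂) (T : E →L[ℝ] E) :
    LinearMap.trace ℝ E T = LinearMap.trace ℝ E₁ (S.π₁.comp (T.comp S.ι₁) : E₁ →L[ℝ] E₁) +
      LinearMap.trace ℝ E₂ (S.π₂.comp (T.comp S.ι₂) : E₂ →L[ℝ] E₂) := by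
  have h : (T : E →ₗ[ℝ] E) = ((T.comp S.ι₁ : E₁ →L[ℝ] E) : E₁ →ₗ[ℝ] E) ∘ₗ (S.π₁ : E →ₗ[ℝ] E₁) +
      ((T.comp S.ι₂ : E₂ →L[ℝ] E) : E₂ →ₗ[ℝ] E) ∘ₗ (S.π₂ : E →ₗ[ℝ] E₂) := by
    ext v
    simp [← map_add]
  rw [h, map_add, LinearMap.trace_comp_comm' (S.π₁ : E →ₗ[ℝ] E₁),
    LinearMap.trace_comp_comm' (S.π₂ : E →ₗ[ℝ] E₂)]
  rfl

/-- A derivative along the first summand only sees the slice through the point. -/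
theorem fderiv_apply_ι₁ {F : Type*} [NormedAddCommGroup F] [NormedSpace ℝ F]
    (S : Splitting E E₁ E₂) {φ : E → F} {x : E} (hφ : DifferentiableAt ℝ φ x) (a : E₁) :
    fderiv ℝ φ x (S.ι₁ a) = fderiv ℝ (fun t ↦ φ (S.ι₁ t + S.ι₂ (S.π₂ x))) (S.π₁ x) a := by
  have hj : HasFDerivAt (fun t ↦ S.ι₁ t + S.ι₂ (S.π₂ x)) S.ι₁ (S.π₁ x) :=
    S.ι₁.hasFDerivAt.add_const _
  have hφ' : HasFDerivAt φ (fderiv ℝ φ x) (S.ι₁ (S.π₁ x) + S.ι₂ (S.π₂ x)) := by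
    rw [S.ι_add_ι]
    exact hφ.hasFDerivAt
  exact (DFunLike.congr_fun (hφ'.comp (S.π₁ x) hj).fderiv a).symm

end Splitting

/-- `G` is, on the product of `U₁` and `U₂`, the doubly warped product of `G₁` and `G₂` with
warping functions `f` and `h`. -/
structure IsWarpedOn (S : Splitting E E₁ E₂) (G : E → E →L[ℝ] E →L[ℝ] ℝ)
    (G₁ : E₁ → E₁ →L[ℝ] E₁ →L[ℝ] ℝ) (G₂ : E₂ → E₂ →L[ℝ] E₂ →L[ℝ] ℝ) (f : E₁ → ℝ) (h : E₂ → ℝ)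
    (U₁ : Set E₁) (U₂ : Set E₂) : Prop where
  metric : IsMetricOn G {x | S.π₁ x ∈ U₁ ∧ S.π₂ x ∈ U₂}
  metric₁ : IsMetricOn G₁ U₁
  metric₂ : IsMetricOn G₂ U₂
  contDiffOn₁ : ContDiffOn ℝ ∞ f U₁
  contDiffOn₂ : ContDiffOn ℝ ∞ h U₂
  pos₁ : ∀ t ∈ U₁, 0 < f t
  pos₂ : ∀ t ∈ U₂, 0 < h t
  apply_eq : ∀ x, S.π₁ x ∈ U₁ → S.π₂ x ∈ U₂ → ∀ v w, G x v w =
    h (S.π₂ x) ^ 2 * G₁ (S.π₁ x) (S.π₁ v) (S.π₁ w) + f (S.π₁ x) ^ 2 * G₂ (S.π₂ x) (S.π₂ v) (S.π₂ w)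

namespace IsWarpedOn

variable {S : Splitting E E₁ E₂} {G : E → E →L[ℝ] E →L[ℝ] ℝ} {G₁ : E₁ → E₁ →L[ℝ] E₁ →L[ℝ] ℝ}
  {G₂ : E₂ → E₂ →L[ℝ] E₂ →L[ℝ] ℝ} {f : E₁ → ℝ} {h : E₂ → ℝ} {U₁ : Set E₁} {U₂ : Set E₂} {x : E}

/-- The two factors play symmetric roles. Working with an abstract splitting instead of a literal
product lets each formula for the first factor be reused for the second. -/
theorem swap (hW : IsWarpedOn S G G₁ G₂ f h U₁ U₂) : IsWarpedOn S.swap G G₂ G₁ h f U₂ U₁ where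
  metric := by
    convert hW.metric using 1
    ext y
    exact and_comm
  metric₁ := hW.metric₂
  metric₂ := hW.metric₁
  contDiffOn₁ := hW.contDiffOn₂
  contDiffOn₂ := hW.contDiffOn₁
  pos₁ := hW.pos₂
  pos₂ := hW.pos₁
  apply_eq y h2 h1 v w := by
    rw [hW.apply_eq y h1 h2, add_comm]
    rfl

theorem contDiffAt₁ (hW : IsWarpedOn S G G₁ G₂ f h U₁ U₂) {t : E₁} (ht : t ∈ U₁) :
    ContDiffAt ℝ ∞ f t :=
  hW.contDiffOn₁.contDiffAt (hW.metric₁.isOpen.mem_nhds ht)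

theorem hasFDerivAt₁ (hW : IsWarpedOn S G G₁ G₂ f h U₁ U₂) {t : E₁} (ht : t ∈ U₁) :
    HasFDerivAt f (fderiv ℝ f t) t :=
  ((hW.contDiffAt₁ ht).differentiableAt (by simp)).hasFDerivAt

theorem hasFDerivAt_inv₁ (hW : IsWarpedOn S G G₁ G₂ f h U₁ U₂) {t : E₁} (ht : t ∈ U₁) :
    HasFDerivAt (fun t ↦ (f t)⁻¹) (-(f t ^ 2)⁻¹ • fderiv ℝ f t) t :=
  (hasDerivAt_inv (hW.pos₁ t ht).ne').comp_hasFDerivAt t (hW.hasFDerivAt₁ ht)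

theorem fderiv_apply (hW : IsWarpedOn S G G₁ G₂ f h U₁ U₂) (h₁ : S.π₁ x ∈ U₁) (h₂ : S.π₂ x ∈ U₂)
    (u v w : E) : fderiv ℝ G x u v w =
      2 * h (S.π₂ x) * fderiv ℝ h (S.π₂ x) (S.π₂ u) * G₁ (S.π₁ x) (S.π₁ v) (S.π₁ w) +
      h (S.π₂ x) ^ 2 * fderiv ℝ G₁ (S.π₁ x) (S.π₁ u) (S.π₁ v) (S.π₁ w) +
      2 * f (S.π₁ x) * fderiv ℝ f (S.π₁ x) (S.π₁ u) * G₂ (S.π₂ x) (S.π₂ v) (S.π₂ w) +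
      f (S.π₁ x) ^ 2 * fderiv ℝ G₂ (S.π₂ x) (S.π₂ u) (S.π₂ v) (S.π₂ w) := by
  have e1 := (hW.hasFDerivAt₁ h₁).comp x S.π₁.hasFDerivAt
  have e2 := (hW.swap.hasFDerivAt₁ h₂).comp x S.π₂.hasFDerivAt
  have e3 := (hW.metric₁.hasFDerivAt_apply h₁ (S.π₁ v) (S.π₁ w)).comp x S.π₁.hasFDerivAt
  have e4 := (hW.metric₂.hasFDerivAt_apply h₂ (S.π₂ v) (S.π₂ w)).comp x S.π₂.hasFDerivAt
  have e5 := ((e2.pow 2).mul e3).add ((e1.pow 2).mul e4)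
  have e6 := hW.metric.hasFDerivAt_apply (x := x) ⟨h₁, h₂⟩ v w
  have e7 := e6.congr_of_eventuallyEq (f₁ := _) (Filter.EventuallyEq.symm
    (Filter.eventually_of_mem (hW.metric.isOpen.mem_nhds ⟨h₁, h₂⟩)
      fun y hy ↦ hW.apply_eq y hy.1 hy.2 v w))
  have e8 := DFunLike.congr_fun (e7.unique e5) u
  simp only [ContinuousLinearMap.flip_apply, add_apply, smul_apply, smul_eq_mul,
    ContinuousLinearMap.comp_apply, Function.comp_apply] at e8
  rw [e8]
  ring

variable [FiniteDimensional ℝ E]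

/-- The first block of the metric carries `h²`, so the Koszul term `-½ ∂_w(h²) G₁(a, b)` survives
for `w` in the second factor; raising its index with `f² G₂` gives the gradient term. -/
theorem christoffel_ι₁_ι₁ [FiniteDimensional ℝ E₁] [FiniteDimensional ℝ E₂]
    (hW : IsWarpedOn S G G₁ G₂ f h U₁ U₂) (h₁ : S.π₁ x ∈ U₁)
    (h₂ : S.π₂ x ∈ U₂) (a b : E₁) : christoffel G x (S.ι₁ a) (S.ι₁ b) =
      S.ι₁ (christoffel G₁ (S.π₁ x) a b) -
        (h (S.π₂ x) / f (S.π₁ x) ^ 2 * G₁ (S.π₁ x) a b) • S.ι₂ (coordGrad G₂ h (S.π₂ x)) := by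
  refine hW.metric.christoffel_eq ⟨h₁, h₂⟩ fun w ↦ ?_
  have hf := (hW.pos₁ _ h₁).ne'
  rw [hW.fderiv_apply h₁ h₂, hW.fderiv_apply h₁ h₂, hW.fderiv_apply h₁ h₂, hW.apply_eq x h₁ h₂]
  simp only [map_sub, map_smul, S.π₁_ι₁, S.π₁_ι₂, S.π₂_ι₁, S.π₂_ι₂, map_zero, smul_zero, sub_zero,
    zero_sub, zero_apply, neg_apply, map_neg, smul_apply, smul_eq_mul,
    hW.metric₂.apply_coordGrad h₂, hW.metric₁.koszul h₁]
  field_simp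
  ring

theorem christoffel_ι₁_ι₂ (hW : IsWarpedOn S G G₁ G₂ f h U₁ U₂) (h₁ : S.π₁ x ∈ U₁)
    (h₂ : S.π₂ x ∈ U₂) (a : E₁) (b : E₂) : christoffel G x (S.ι₁ a) (S.ι₂ b) =
      (fderiv ℝ h (S.π₂ x) b / h (S.π₂ x)) • S.ι₁ a +
        (fderiv ℝ f (S.π₁ x) a / f (S.π₁ x)) • S.ι₂ b := by
  refine hW.metric.christoffel_eq ⟨h₁, h₂⟩ fun w ↦ ?_
  have hf := (hW.pos₁ _ h₁).ne'
  have hh := (hW.pos₂ _ h₂).ne'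
  rw [hW.fderiv_apply h₁ h₂, hW.fderiv_apply h₁ h₂, hW.fderiv_apply h₁ h₂, hW.apply_eq x h₁ h₂]
  simp only [map_add, map_smul, S.π₁_ι₁, S.π₁_ι₂, S.π₂_ι₁, S.π₂_ι₂, map_zero, smul_zero, add_zero,
    zero_add, zero_apply, smul_apply, smul_eq_mul]
  field_simp
  ring

theorem christoffel_ι₂_ι₁ (hW : IsWarpedOn S G G₁ G₂ f h U₁ U₂) (h₁ : S.π₁ x ∈ U₁)
    (h₂ : S.π₂ x ∈ U₂) (b : E₂) (a : E₁) : christoffel G x (S.ι₂ b) (S.ι₁ a) =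
      (fderiv ℝ h (S.π₂ x) b / h (S.π₂ x)) • S.ι₁ a +
        (fderiv ℝ f (S.π₁ x) a / f (S.π₁ x)) • S.ι₂ b := by
  rw [hW.metric.christoffel_symm ⟨h₁, h₂⟩, hW.christoffel_ι₁_ι₂ h₁ h₂]

theorem christoffel_ι₂_ι₂ [FiniteDimensional ℝ E₁] [FiniteDimensional ℝ E₂]
    (hW : IsWarpedOn S G G₁ G₂ f h U₁ U₂) (h₁ : S.π₁ x ∈ U₁)
    (h₂ : S.π₂ x ∈ U₂) (a b : E₂) : christoffel G x (S.ι₂ a) (S.ι₂ b) =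
      S.ι₂ (christoffel G₂ (S.π₂ x) a b) -
        (f (S.π₁ x) / h (S.π₂ x) ^ 2 * G₂ (S.π₂ x) a b) • S.ι₁ (coordGrad G₁ f (S.π₁ x)) :=
  hW.swap.christoffel_ι₁_ι₁ h₂ h₁ a b

/-- A component of the derivative of the Christoffel symbols along the first factor. -/
theorem fderiv_christoffel_ι₁ {F : Type*} [NormedAddCommGroup F] [NormedSpace ℝ F]
    (hW : IsWarpedOn S G G₁ G₂ f h U₁ U₂) (h₁ : S.π₁ x ∈ U₁) (h₂ : S.π₂ x ∈ U₂)
    (P : E →L[ℝ] F) {v w : E} {φ : E₁ → F} {φ' : E₁ →L[ℝ] F} (hφ' : HasFDerivAt φ φ' (S.π₁ x))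
    (hφ : ∀ y, S.π₁ y ∈ U₁ → S.π₂ y = S.π₂ x → P (christoffel G y v w) = φ (S.π₁ y)) (a : E₁) :
    P (fderiv ℝ (christoffel G) x (S.ι₁ a) v w) = φ' a := by
  -- The derivative is taken on the slice through `x`, so `hφ` is needed only there and quantities
  -- of the second factor count as constants.
  have e1 := hW.metric.hasFDerivAt_christoffel_apply (x := x) ⟨h₁, h₂⟩ v w
  have e2 := (P.hasFDerivAt.comp x e1)
  have e3 := S.fderiv_apply_ι₁ e2.differentiableAt a
  rw [e2.fderiv] at e3
  have e4 : (fun t ↦ (P ∘ fun y ↦ christoffel G y v w) (S.ι₁ t + S.ι₂ (S.π₂ x)))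
      =ᶠ[nhds (S.π₁ x)] φ := by
    filter_upwards [hW.metric₁.isOpen.mem_nhds h₁] with t ht
    simpa using hφ (S.ι₁ t + S.ι₂ (S.π₂ x)) (by simpa using ht) (by simp)
  rw [e4.fderiv_eq, hφ'.fderiv] at e3
  exact e3

theorem fderiv_christoffel_ι₂ {F : Type*} [NormedAddCommGroup F] [NormedSpace ℝ F]
    (hW : IsWarpedOn S G G₁ G₂ f h U₁ U₂) (h₁ : S.π₁ x ∈ U₁) (h₂ : S.π₂ x ∈ U₂)
    (P : E →L[ℝ] F) {v w : E} {φ : E₂ → F} {φ' : E₂ →L[ℝ] F} (hφ' : HasFDerivAt φ φ' (S.π₂ x))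
    (hφ : ∀ y, S.π₂ y ∈ U₂ → S.π₁ y = S.π₁ x → P (christoffel G y v w) = φ (S.π₂ y)) (a : E₂) :
    P (fderiv ℝ (christoffel G) x (S.ι₂ a) v w) = φ' a :=
  hW.swap.fderiv_christoffel_ι₁ h₂ h₁ P hφ' hφ a

end IsWarpedOn

end LocalWarped

end DoublyWarped

/-! ### Curvature blocks, the Ricci tensor and its covariant derivative. -/

namespace DoublyWarped

section LocalRicci

variable {E E₁ E₂ : Type*} [NormedAddCommGroup E] [NormedSpace ℝ E]
  [NormedAddCommGroup E₁] [NormedSpace ℝ E₁] [NormedAddCommGroup E₂] [NormedSpace ℝ E₂]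
  [FiniteDimensional ℝ E] [FiniteDimensional ℝ E₁] [FiniteDimensional ℝ E₂]

/-- Multiples of the identity minus rank-one maps are the shape of the mixed curvature blocks and of
the correction term in the block tangent to one factor. -/
theorem trace_smul_id_sub_smulRight (c d : ℝ) (α : E →L[ℝ] ℝ) (v : E) :
    LinearMap.trace ℝ E ((c • ContinuousLinearMap.id ℝ E - d • α.smulRight v : E →L[ℝ] E) :
      E →ₗ[ℝ] E) = c * Module.finrank ℝ E - d * α v := by
  have h : ((c • ContinuousLinearMap.id ℝ E - d • α.smulRight v : E →L[ℝ] E) : E →ₗ[ℝ] E) =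
      c • LinearMap.id - d • (α : E →ₗ[ℝ] ℝ).smulRight v := by
    ext; simp
  rw [h, map_sub, map_smul, map_smul, LinearMap.trace_id, LinearMap.trace_smulRight]
  simp

namespace IsWarpedOn

variable {S : Splitting E E₁ E₂} {G : E → E →L[ℝ] E →L[ℝ] ℝ} {G₁ : E₁ → E₁ →L[ℝ] E₁ →L[ℝ] ℝ}
  {G₂ : E₂ → E₂ →L[ℝ] E₂ →L[ℝ] ℝ} {f : E₁ → ℝ} {h : E₂ → ℝ} {U₁ : Set E₁} {U₂ : Set E₂} {x : E}

/-- This is the Gauss equation: slices are totally umbilic with second fundamental form `-(h / f²)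
G₁ ∇h`, which gives a correction of constant-curvature type. -/
theorem curvature_block₁₁ (hW : IsWarpedOn S G G₁ G₂ f h U₁ U₂) (h₁ : S.π₁ x ∈ U₁)
    (h₂ : S.π₂ x ∈ U₂) (Y Z : E₁) :
    S.π₁.comp ((curvature G x (S.ι₁ Y) (S.ι₁ Z)).comp S.ι₁) = curvature G₁ (S.π₁ x) Y Z -
      (fderiv ℝ h (S.π₂ x) (coordGrad G₂ h (S.π₂ x)) / f (S.π₁ x) ^ 2) •
        (G₁ (S.π₁ x) Y Z • ContinuousLinearMap.id ℝ E₁ -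
          (1 : ℝ) • ((G₁ (S.π₁ x)).flip Z).smulRight Y) := by
  have hf := (hW.pos₁ _ h₁).ne'
  have hh := (hW.pos₂ _ h₂).ne'
  ext a
  have key (a b c : E₁) : S.π₁ (fderiv ℝ (christoffel G) x (S.ι₁ a) (S.ι₁ b) (S.ι₁ c)) =
      fderiv ℝ (christoffel G₁) (S.π₁ x) a b c :=
    hW.fderiv_christoffel_ι₁ h₁ h₂ S.π₁ (hW.metric₁.hasFDerivAt_christoffel_apply h₁ b c)
      (fun y hy hy' ↦ by rw [hW.christoffel_ι₁_ι₁ hy (hy' ▸ h₂)]; simp) a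
  simp only [ContinuousLinearMap.comp_apply, curvature_apply, map_add, map_sub, key,
    hW.christoffel_ι₁_ι₁ h₁ h₂, hW.christoffel_ι₁_ι₂ h₁ h₂, map_smul, S.π₁_ι₁, S.π₁_ι₂,
    smul_zero, add_zero, sub_zero, sub_apply, smul_apply, ContinuousLinearMap.id_apply,
    ContinuousLinearMap.smulRight_apply, ContinuousLinearMap.flip_apply]
  match_scalars <;> field_simp

/-- Differentiating `h ∇h` along the second factor and `df / f` along the first leaves `h D∇h` and
the Hessian of `f`. The quadratic terms `dh ⊗ ∇h` and `df ⊗ df` cancel against products of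
Christoffel symbols. -/
theorem curvature_block₂₁ (hW : IsWarpedOn S G G₁ G₂ f h U₁ U₂) (h₁ : S.π₁ x ∈ U₁)
    (h₂ : S.π₂ x ∈ U₂) (Y Z : E₁) :
    S.π₂.comp ((curvature G x (S.ι₁ Y) (S.ι₁ Z)).comp S.ι₂) =
      -((h (S.π₂ x) / f (S.π₁ x) ^ 2 * G₁ (S.π₁ x) Y Z) •
        (fderiv ℝ (coordGrad G₂ h) (S.π₂ x) +
          (christoffel G₂ (S.π₂ x)).flip (coordGrad G₂ h (S.π₂ x))) +
      (hessian G₁ f (S.π₁ x) Y Z / f (S.π₁ x)) • ContinuousLinearMap.id ℝ E₂) := by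
  have hf := (hW.pos₁ _ h₁).ne'
  have hh := (hW.pos₂ _ h₂).ne'
  ext b
  have key1 := hW.fderiv_christoffel_ι₂ h₁ h₂ S.π₂ (v := S.ι₁ Y) (w := S.ι₁ Z)
    ((((hW.swap.hasFDerivAt₁ h₂).mul_const (G₁ (S.π₁ x) Y Z / f (S.π₁ x) ^ 2)).smul
      ((hW.metric₂.contDiffAt_coordGrad h₂ (hW.swap.contDiffAt₁ h₂)).differentiableAt
        (by simp)).hasFDerivAt).neg)
    (fun y hy hy' ↦ by
      rw [hW.christoffel_ι₁_ι₁ (hy' ▸ h₁) hy, hy']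
      simp only [map_sub, map_smul, S.π₂_ι₁, S.π₂_ι₂, zero_sub, Pi.neg_apply, Pi.smul_apply']
      congr 2
      ring) b
  have hf1 : ContDiffAt ℝ ∞ (fderiv ℝ f) (S.π₁ x) :=
    (hW.contDiffAt₁ h₁).fderiv_right (by simp)
  have hf2 := (hf1.differentiableAt (by simp)).hasFDerivAt.clm_apply (hasFDerivAt_const Z (S.π₁ x))
  have hf3 := hW.hasFDerivAt_inv₁ h₁
  have key2 := hW.fderiv_christoffel_ι₁ h₁ h₂ S.π₂ (v := S.ι₂ b) (w := S.ι₁ Z)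
    ((hf2.mul hf3).smul_const b)
    (fun y hy hy' ↦ by
      rw [hW.christoffel_ι₂_ι₁ hy (hy' ▸ h₂)]
      simp [div_eq_mul_inv]) Y
  have hH : hessian G₁ f (S.π₁ x) Y Z = fderiv ℝ (fderiv ℝ f) (S.π₁ x) Y Z -
      fderiv ℝ f (S.π₁ x) (christoffel G₁ (S.π₁ x) Y Z) := rfl
  simp only [ContinuousLinearMap.comp_apply, curvature_apply, map_add, map_sub, key1, key2,
    hW.christoffel_ι₁_ι₁ h₁ h₂, hW.christoffel_ι₁_ι₂ h₁ h₂, hW.christoffel_ι₂_ι₁ h₁ h₂,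
    hW.christoffel_ι₂_ι₂ h₁ h₂, map_smul, S.π₂_ι₁, S.π₂_ι₂, hH,
    smul_zero, zero_add, zero_sub, sub_zero, smul_apply, neg_apply, add_apply,
    ContinuousLinearMap.id_apply, ContinuousLinearMap.smulRight_apply,
    ContinuousLinearMap.flip_apply, ContinuousLinearMap.comp_zero, smul_eq_mul]
  match_scalars <;> field_simp <;> ring

/-- The umbilic correction has trace `(n₁ - 1) dh(∇h) / f²` times `G₁`, and the other block
contributes `h Δh` and `n₂ H^f / f`; together they form `h^◇` and `𝓕`. -/
theorem ricci_ι₁_ι₁ (hW : IsWarpedOn S G G₁ G₂ f h U₁ U₂) (h₁ : S.π₁ x ∈ U₁)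
    (h₂ : S.π₂ x ∈ U₂) (Y Z : E₁) :
    ricci G x (S.ι₁ Y) (S.ι₁ Z) = ricci G₁ (S.π₁ x) Y Z -
      Module.finrank ℝ E₂ / f (S.π₁ x) * hessian G₁ f (S.π₁ x) Y Z -
      (h (S.π₂ x) * laplacian G₂ h (S.π₂ x) + ((Module.finrank ℝ E₁ : ℝ) - 1) *
        fderiv ℝ h (S.π₂ x) (coordGrad G₂ h (S.π₂ x))) / f (S.π₁ x) ^ 2 * G₁ (S.π₁ x) Y Z := by
  rw [ricci, S.trace_eq, hW.curvature_block₁₁ h₁ h₂, hW.curvature_block₂₁ h₁ h₂,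
    ContinuousLinearMap.toLinearMap_sub, map_sub, ContinuousLinearMap.toLinearMap_smul, map_smul,
    trace_smul_id_sub_smulRight, ContinuousLinearMap.toLinearMap_neg, map_neg,
    ContinuousLinearMap.toLinearMap_add, map_add, ContinuousLinearMap.toLinearMap_smul, map_smul,
    hW.metric₂.trace_hessian h₂ (hW.swap.contDiffAt₁ h₂), ContinuousLinearMap.toLinearMap_smul,
    map_smul, ContinuousLinearMap.coe_id, LinearMap.trace_id, ricci]
  simp only [smul_eq_mul, ContinuousLinearMap.flip_apply]
  ring

theorem curvature_block₁₂ (hW : IsWarpedOn S G G₁ G₂ f h U₁ U₂) (h₁ : S.π₁ x ∈ U₁)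
    (h₂ : S.π₂ x ∈ U₂) (Y : E₁) (W : E₂) :
    S.π₁.comp ((curvature G x (S.ι₁ Y) (S.ι₂ W)).comp S.ι₁) =
      (fderiv ℝ f (S.π₁ x) Y * fderiv ℝ h (S.π₂ x) W / (f (S.π₁ x) * h (S.π₂ x))) •
        ContinuousLinearMap.id ℝ E₁ -
      (fderiv ℝ h (S.π₂ x) W / (f (S.π₁ x) * h (S.π₂ x))) •
        (fderiv ℝ f (S.π₁ x)).smulRight Y := by
  have hf := (hW.pos₁ _ h₁).ne'
  have hh := (hW.pos₂ _ h₂).ne'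
  ext a
  have key (a b : E₁) : S.π₁ (fderiv ℝ (christoffel G) x (S.ι₁ a) (S.ι₁ b) (S.ι₂ W)) = 0 :=
    hW.fderiv_christoffel_ι₁ h₁ h₂ S.π₁
      (hasFDerivAt_const ((fderiv ℝ h (S.π₂ x) W / h (S.π₂ x)) • b) _)
      (fun y hy hy' ↦ by rw [hW.christoffel_ι₁_ι₂ hy (hy' ▸ h₂), hy']; simp) a
  simp only [ContinuousLinearMap.comp_apply, curvature_apply, map_add, map_sub, key,
    hW.christoffel_ι₁_ι₁ h₁ h₂, hW.christoffel_ι₁_ι₂ h₁ h₂, map_smul, S.π₁_ι₁, S.π₁_ι₂,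
    smul_zero, add_zero, zero_add, sub_zero, sub_apply, smul_apply, ContinuousLinearMap.id_apply,
    ContinuousLinearMap.smulRight_apply, hW.metric₁.christoffel_symm h₁ Y a]
  match_scalars <;> field_simp
  ring

theorem curvature_block₂₂ (hW : IsWarpedOn S G G₁ G₂ f h U₁ U₂) (h₁ : S.π₁ x ∈ U₁)
    (h₂ : S.π₂ x ∈ U₂) (Y : E₁) (W : E₂) :
    S.π₂.comp ((curvature G x (S.ι₁ Y) (S.ι₂ W)).comp S.ι₂) =
      (fderiv ℝ f (S.π₁ x) Y * fderiv ℝ h (S.π₂ x) W / (f (S.π₁ x) * h (S.π₂ x))) •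
        ContinuousLinearMap.id ℝ E₂ -
      (fderiv ℝ f (S.π₁ x) Y / (f (S.π₁ x) * h (S.π₂ x))) •
        ((G₂ (S.π₂ x)).flip W).smulRight (coordGrad G₂ h (S.π₂ x)) := by
  have hf := (hW.pos₁ _ h₁).ne'
  have hh := (hW.pos₂ _ h₂).ne'
  ext b
  have key1 : S.π₂ (fderiv ℝ (christoffel G) x (S.ι₂ b) (S.ι₁ Y) (S.ι₂ W)) = 0 :=
    hW.fderiv_christoffel_ι₂ h₁ h₂ S.π₂
      (hasFDerivAt_const ((fderiv ℝ f (S.π₁ x) Y / f (S.π₁ x)) • W) _)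
      (fun y hy hy' ↦ by rw [hW.christoffel_ι₁_ι₂ (hy' ▸ h₁) hy, hy']; simp) b
  have key2 : S.π₂ (fderiv ℝ (christoffel G) x (S.ι₁ Y) (S.ι₂ b) (S.ι₂ W)) = 0 :=
    hW.fderiv_christoffel_ι₁ h₁ h₂ S.π₂
      (hasFDerivAt_const (christoffel G₂ (S.π₂ x) b W) _)
      (fun y hy hy' ↦ by rw [hW.christoffel_ι₂_ι₂ hy (hy' ▸ h₂), hy']; simp) Y
  simp only [ContinuousLinearMap.comp_apply, curvature_apply, map_add, map_sub, key1, key2,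
    hW.christoffel_ι₁_ι₁ h₁ h₂, hW.christoffel_ι₁_ι₂ h₁ h₂, hW.christoffel_ι₂_ι₁ h₁ h₂,
    hW.christoffel_ι₂_ι₂ h₁ h₂, map_smul, S.π₂_ι₁, S.π₂_ι₂, hW.metric₁.apply_coordGrad' h₁,
    smul_zero, zero_add, zero_sub, sub_zero, sub_apply, smul_apply,
    ContinuousLinearMap.id_apply, ContinuousLinearMap.smulRight_apply,
    ContinuousLinearMap.flip_apply]
  match_scalars <;> field_simp
  ring

/-- The two diagonal blocks contribute `n₁ - 1` and `n₂ - 1`, which is where the factor `n - 2`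
comes from. -/
theorem ricci_ι₁_ι₂ (hW : IsWarpedOn S G G₁ G₂ f h U₁ U₂) (h₁ : S.π₁ x ∈ U₁)
    (h₂ : S.π₂ x ∈ U₂) (Y : E₁) (W : E₂) :
    ricci G x (S.ι₁ Y) (S.ι₂ W) = ((Module.finrank ℝ E₁ + Module.finrank ℝ E₂ : ℝ) - 2) *
      (fderiv ℝ f (S.π₁ x) Y * fderiv ℝ h (S.π₂ x) W / (f (S.π₁ x) * h (S.π₂ x))) := by
  rw [ricci, S.trace_eq, hW.curvature_block₁₂ h₁ h₂, hW.curvature_block₂₂ h₁ h₂,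
    trace_smul_id_sub_smulRight, trace_smul_id_sub_smulRight]
  simp only [ContinuousLinearMap.flip_apply, hW.metric₂.apply_coordGrad h₂]
  ring

theorem ricci_ι₂_ι₁ (hW : IsWarpedOn S G G₁ G₂ f h U₁ U₂) (h₁ : S.π₁ x ∈ U₁)
    (h₂ : S.π₂ x ∈ U₂) (W : E₂) (Y : E₁) :
    ricci G x (S.ι₂ W) (S.ι₁ Y) = ((Module.finrank ℝ E₁ + Module.finrank ℝ E₂ : ℝ) - 2) *
      (fderiv ℝ f (S.π₁ x) Y * fderiv ℝ h (S.π₂ x) W / (f (S.π₁ x) * h (S.π₂ x))) := by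
  refine (hW.swap.ricci_ι₁_ι₂ h₂ h₁ W Y).trans ?_
  change ((Module.finrank ℝ E₂ + Module.finrank ℝ E₁ : ℝ) - 2) *
    (fderiv ℝ h (S.π₂ x) W * fderiv ℝ f (S.π₁ x) Y / (h (S.π₂ x) * f (S.π₁ x))) = _
  ring

/-- The covariant derivative of the Ricci tensor of a doubly warped product along a factor. -/
theorem covDeriv_ricci (hW : IsWarpedOn S G G₁ G₂ f h U₁ U₂) (h₁ : S.π₁ x ∈ U₁)
    (h₂ : S.π₂ x ∈ U₂) (X Y Z : E₁) :
    covDeriv G (ricci G) x (S.ι₁ X) (S.ι₁ Y) (S.ι₁ Z) =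
      covDeriv G₁ (ricci G₁) (S.π₁ x) X Y Z -
      covDeriv G₁ (fun t v w ↦ Module.finrank ℝ E₂ / f t * hessian G₁ f t v w) (S.π₁ x) X Y Z +
      ((Module.finrank ℝ E₁ + Module.finrank ℝ E₂ : ℝ) - 2) / f (S.π₁ x) ^ 3 *
        (G₁ (S.π₁ x) X Y * fderiv ℝ f (S.π₁ x) Z + G₁ (S.π₁ x) X Z * fderiv ℝ f (S.π₁ x) Y) *
          fderiv ℝ h (S.π₂ x) (coordGrad G₂ h (S.π₂ x)) +
      2 * ((h (S.π₂ x) * laplacian G₂ h (S.π₂ x) + ((Module.finrank ℝ E₁ : ℝ) - 1) *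
        fderiv ℝ h (S.π₂ x) (coordGrad G₂ h (S.π₂ x))) / f (S.π₁ x) ^ 3) *
          fderiv ℝ f (S.π₁ x) X * G₁ (S.π₁ x) Y Z := by
  have hf := (hW.pos₁ _ h₁).ne'
  have hh := (hW.pos₂ _ h₂).ne'
  -- `k` is `h^◇` at the second coordinate of the point, constant along the first factor.
  set k : ℝ := h (S.π₂ x) * laplacian G₂ h (S.π₂ x) + ((Module.finrank ℝ E₁ : ℝ) - 1) *
    fderiv ℝ h (S.π₂ x) (coordGrad G₂ h (S.π₂ x)) with hk
  have hR := (hW.metric₁.differentiableAt_ricci h₁ Y Z).hasFDerivAt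
  have hF : DifferentiableAt ℝ (fun t ↦ Module.finrank ℝ E₂ / f t * hessian G₁ f t Y Z)
      (S.π₁ x) := by
    simp only [div_eq_mul_inv]
    refine DifferentiableAt.mul ?_ ?_
    · exact (hW.hasFDerivAt_inv₁ h₁).differentiableAt.const_mul _
    · exact ((((hW.metric₁.contDiffAt_hessian h₁ (hW.contDiffAt₁ h₁)).clm_apply
        contDiffAt_const).clm_apply contDiffAt_const).differentiableAt (by simp))
  have hf3 := (((hW.hasFDerivAt_inv₁ h₁).pow 2).const_mul k).mul
    (hW.metric₁.hasFDerivAt_apply h₁ Y Z)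
  have hEq : (fun t ↦ ricci G (S.ι₁ t + S.ι₂ (S.π₂ x)) (S.ι₁ Y) (S.ι₁ Z)) =ᶠ[nhds (S.π₁ x)]
      fun t ↦ ricci G₁ t Y Z - Module.finrank ℝ E₂ / f t * hessian G₁ f t Y Z -
        k * (f t)⁻¹ ^ 2 * G₁ t Y Z := by
    filter_upwards [hW.metric₁.isOpen.mem_nhds h₁] with t ht
    rw [hW.ricci_ι₁_ι₁ (by simpa using ht) (by simpa using h₂)]
    simp [hk, div_eq_mul_inv]
  have hD := ((hR.sub hF.hasFDerivAt).sub hf3).congr_of_eventuallyEq hEq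
  have e1 := S.fderiv_apply_ι₁
    (hW.metric.differentiableAt_ricci (x := x) ⟨h₁, h₂⟩ (S.ι₁ Y) (S.ι₁ Z)) X
  rw [hD.fderiv] at e1
  have e2 : christoffel G x (S.ι₁ X) (S.ι₁ Y) = _ := hW.christoffel_ι₁_ι₁ h₁ h₂ X Y
  have e3 : christoffel G x (S.ι₁ X) (S.ι₁ Z) = _ := hW.christoffel_ι₁_ι₁ h₁ h₂ X Z
  simp only [covDeriv]
  -- Expand `Ric(∇_X Y, Z)` and `Ric(Y, ∇_X Z)` by bilinearity. The `∇h` components meet the mixed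
  -- Ricci tensor and give the `n - 2` terms.
  rw [e1, e2, e3, sub_eq_add_neg (S.ι₁ _), sub_eq_add_neg (S.ι₁ _), ← neg_smul, ← neg_smul,
    ricci_add_left, ricci_smul_left, ricci_add_right, ricci_smul_right, hW.ricci_ι₁_ι₁ h₁ h₂,
    hW.ricci_ι₁_ι₁ h₁ h₂, hW.ricci_ι₂_ι₁ h₁ h₂, hW.ricci_ι₁_ι₂ h₁ h₂]
  -- Since `G₁` is parallel, its derivative cancels against the Christoffel terms, and only the
  -- derivative of `k f⁻²` remains from the last summand of Ricci.
  simp only [sub_apply, add_apply, smul_apply, smul_eq_mul, ContinuousLinearMap.flip_apply,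
    hW.metric₁.fderiv_eq h₁ X Y Z, ← hk, Nat.reduceSub, pow_one, nsmul_eq_mul, Nat.cast_ofNat]
  field_simp
  ring

end IsWarpedOn

end LocalRicci

end DoublyWarped

/-! ### Passage from manifolds to preferred charts. -/

namespace DoublyWarped

section Charts

variable {E : Type*} [NormedAddCommGroup E] [NormedSpace ℝ E]
  {H : Type*} [TopologicalSpace H] {I : ModelWithCorners ℝ E H}
  {M : Type*} [TopologicalSpace M] [ChartedSpace H M]

theorem contDiffOn_comp_extChartAt_symm [IsManifold I ∞ M] {f : M → ℝ} (hf : ContMDiff I 𝓘(ℝ) ∞ f) (p : M) :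
    ContDiffOn ℝ ∞ (f ∘ (extChartAt I p).symm) (extChartAt I p).target :=
  contMDiffOn_iff_contDiffOn.1 (hf.comp_contMDiffOn (contMDiffOn_extChartAt_symm p))

theorem mvfderiv_eq_fderiv_comp_extChartAt_symm [I.Boundaryless] {f : M → ℝ}
    (hf : ContMDiff I 𝓘(ℝ) ∞ f) (p : M) :
    mvfderiv I f p = fderiv ℝ (f ∘ (extChartAt I p).symm) (extChartAt I p p) := by
  have h := (hf p).mdifferentiableAt (by simp)
  rw [mvfderiv, h.mfderiv, I.range_eq_univ, fderivWithin_univ]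
  rfl

namespace PseudoRiemannianMetric

variable [IsManifold I ∞ M]

theorem inChart_apply (g : PseudoRiemannianMetric I M) (p : M) (y v w : E) :
    g.inChart p y v w = g.inner ((extChartAt I p).symm y)
      (mfderiv 𝓘(ℝ, E) I (extChartAt I p).symm y v)
      (mfderiv 𝓘(ℝ, E) I (extChartAt I p).symm y w) :=
  rfl

/-- The preferred chart at `p` has identity derivative at `p`, since `TangentSpace I p` is modelled
by that chart. -/
theorem covDerivAt_eq (g : PseudoRiemannianMetric I M) (p : M) (S : E → E → E → ℝ)
    (X Y Z : TangentSpace I p) :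
    g.covDerivAt p S X Y Z = covDeriv (g.inChart p) S (extChartAt I p p) X Y Z := by
  have : IsManifold I 1 M := IsManifold.of_le (n := ∞) (by simp)
  rw [covDerivAt, mfderiv_extChartAt_self]
  rfl

variable [I.Boundaryless]

/-- Smoothness is read off in the tangent trivialization at `p`, whose inverse is the derivative of
the inverse chart; nondegeneracy transfers because that derivative is invertible. -/
theorem isMetricOn_inChart (g : PseudoRiemannianMetric I M) (p : M) :
    IsMetricOn (g.inChart p) (extChartAt I p).target := by
  have : IsManifold I 1 M := IsManifold.of_le (n := ∞) (by simp)
  refine ⟨isOpen_extChartAt_target p, ?_, fun y _ v w ↦ g.symm _ _ _, fun y hy v hv ↦ ?_⟩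
  · have h1 := (Bundle.Trivialization.contMDiffOn_section_iff (n := ∞) (IB := I)
      (trivializationAt (E →L[ℝ] E →L[ℝ] ℝ)
        (fun p : M ↦ TangentSpace I p →L[ℝ] TangentSpace I p →L[ℝ] ℝ) p)
      (s := g.inner) (a := (chartAt H p).source) (chartAt H p).open_source
      (by intro x hx; simpa using hx)).1 g.contMDiff.contMDiffOn
    have h2 := contMDiffOn_iff_contDiffOn.1 (h1.comp (contMDiffOn_extChartAt_symm (n := ∞) p)
      (fun y hy ↦ by simpa using (extChartAt I p).map_target hy))
    refine h2.congr fun y hy ↦ ?_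
    have hx : (extChartAt I p).symm y ∈ (chartAt H p).source := by
      simpa using (extChartAt I p).map_target hy
    have hb : (extChartAt I p).symm y ∈ (trivializationAt E (TangentSpace I) p).baseSet := by
      simpa using hx
    ext v w
    simp only [Function.comp_apply, hom_trivializationAt_apply]
    rw [inCoordinates_apply_eq₂ hb hb (Set.mem_univ _), inChart_apply]
    have e (u : E) : (trivializationAt E (TangentSpace I) p).symm ((extChartAt I p).symm y) u =
        mfderiv 𝓘(ℝ, E) I (extChartAt I p).symm y u := by
      rw [← Bundle.Trivialization.symmL_apply (R := ℝ) _ hb,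
        TangentBundle.symmL_trivializationAt hx, I.range_eq_univ, mfderivWithin_univ,
        (extChartAt I p).right_inv hy]
      rfl
    rw [e, e]
    simp
  · have hinv : (mfderiv 𝓘(ℝ, E) I (extChartAt I p).symm y).IsInvertible := by
      have := isInvertible_mfderivWithin_extChartAt_symm (I := I) hy
      rwa [I.range_eq_univ, mfderivWithin_univ] at this
    refine hinv.injective ((g.nondegenerate _ _ fun w ↦ ?_).trans (map_zero _).symm)
    obtain ⟨w, rfl⟩ := hinv.surjective w
    exact hv w

theorem inChart_self (g : PseudoRiemannianMetric I M) (p : M) (v w : TangentSpace I p) :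
    g.inChart p (extChartAt I p p) v w = g.inner p v w := by
  have : IsManifold I 1 M := IsManifold.of_le (n := ∞) (by simp)
  have h := mfderivWithin_range_extChartAt_symm (I := I) (x := p)
  rw [I.range_eq_univ, mfderivWithin_univ] at h
  -- The inverse chart returns `p` only up to a propositional equality, so the base point is
  -- generalized before substituting.
  have key (q : M) (hq : q = p) (T : E →L[ℝ] E) (hT : T = .id ℝ E) :
      g.inner q (T v) (T w) = g.inner p v w := by
    subst hq hT
    rfl
  exact key _ (extChartAt_to_inv p) _ h

theorem grad_eq (g : PseudoRiemannianMetric I M) {f : M → ℝ} (hf : ContMDiff I 𝓘(ℝ) ∞ f)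
    (p : M) : g.grad f p =
      coordGrad (g.inChart p) (f ∘ (extChartAt I p).symm) (extChartAt I p p) := by
  have h : g.inChart p (extChartAt I p p) = g.inner p := by
    ext v w
    exact g.inChart_self p v w
  rw [grad, coordGrad, h, mvfderiv_eq_fderiv_comp_extChartAt_symm hf]
  rfl

theorem inner_grad [FiniteDimensional ℝ E] (g : PseudoRiemannianMetric I M) {f : M → ℝ}
    (hf : ContMDiff I 𝓘(ℝ) ∞ f) (p : M) (v : TangentSpace I p) :
    g.inner p (g.grad f p) v = mvfderiv I f p v := by
  rw [← g.inChart_self, g.grad_eq hf, mvfderiv_eq_fderiv_comp_extChartAt_symm hf]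
  exact (g.isMetricOn_inChart p).apply_coordGrad (mem_extChartAt_target p) _ v

end PseudoRiemannianMetric

end Charts

/-! ### The doubly warped product in product charts. -/

section Product

variable {E₁ : Type*} [NormedAddCommGroup E₁] [NormedSpace ℝ E₁]
  {E₂ : Type*} [NormedAddCommGroup E₂] [NormedSpace ℝ E₂]
  {H₁ : Type*} [TopologicalSpace H₁] {H₂ : Type*} [TopologicalSpace H₂]
  {I₁ : ModelWithCorners ℝ E₁ H₁} [I₁.Boundaryless]
  {I₂ : ModelWithCorners ℝ E₂ H₂} [I₂.Boundaryless]
  {M₁ : Type*} [TopologicalSpace M₁] [ChartedSpace H₁ M₁] [IsManifold I₁ ∞ M₁]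
  {M₂ : Type*} [TopologicalSpace M₂] [ChartedSpace H₂ M₂] [IsManifold I₂ ∞ M₂]
  (g₁ : PseudoRiemannianMetric I₁ M₁) (g₂ : PseudoRiemannianMetric I₂ M₂)
  {f₁ : M₁ → ℝ} {f₂ : M₂ → ℝ}
  (hf₁ : ContMDiff I₁ 𝓘(ℝ) ∞ f₁) (hf₂ : ContMDiff I₂ 𝓘(ℝ) ∞ f₂)
  (hpos₁ : ∀ p, 0 < f₁ p) (hpos₂ : ∀ p, 0 < f₂ p)

/-- The preferred chart of a product is the product of the preferred charts, so its inverse has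
block-diagonal derivative and the warped form persists in coordinates. -/
theorem isWarpedOn_inChart (p : M₁ × M₂) :
    IsWarpedOn (Splitting.prod E₁ E₂)
      ((doublyWarpedProduct g₁ g₂ f₁ f₂ hf₁ hf₂ hpos₁ hpos₂).inChart p)
      (g₁.inChart p.1) (g₂.inChart p.2) (f₁ ∘ (extChartAt I₁ p.1).symm)
      (f₂ ∘ (extChartAt I₂ p.2).symm) (extChartAt I₁ p.1).target (extChartAt I₂ p.2).target where
  metric := by
    have h := (doublyWarpedProduct g₁ g₂ f₁ f₂ hf₁ hf₂ hpos₁ hpos₂).isMetricOn_inChart p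
    rwa [extChartAt_prod] at h
  metric₁ := g₁.isMetricOn_inChart p.1
  metric₂ := g₂.isMetricOn_inChart p.2
  contDiffOn₁ := contDiffOn_comp_extChartAt_symm hf₁ p.1
  contDiffOn₂ := contDiffOn_comp_extChartAt_symm hf₂ p.2
  pos₁ _ _ := hpos₁ _
  pos₂ _ _ := hpos₂ _
  apply_eq y h₁ h₂ v w := by
    have : IsManifold I₁ 1 M₁ := IsManifold.of_le (n := ∞) (by simp)
    have : IsManifold I₂ 1 M₂ := IsManifold.of_le (n := ∞) (by simp)
    have d₁ : MDifferentiableAt 𝓘(ℝ, E₁) I₁ (extChartAt I₁ p.1).symm y.1 := by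
      have := mdifferentiableWithinAt_extChartAt_symm (I := I₁) h₁
      rwa [I₁.range_eq_univ, mdifferentiableWithinAt_univ] at this
    have d₂ : MDifferentiableAt 𝓘(ℝ, E₂) I₂ (extChartAt I₂ p.2).symm y.2 := by
      have := mdifferentiableWithinAt_extChartAt_symm (I := I₂) h₂
      rwa [I₂.range_eq_univ, mdifferentiableWithinAt_univ] at this
    have hsymm : (extChartAt (I₁.prod I₂) p).symm =
        Prod.map (extChartAt I₁ p.1).symm (extChartAt I₂ p.2).symm := by
      rw [extChartAt_prod]
      rfl
    have hd : mfderiv 𝓘(ℝ, E₁ × E₂) (I₁.prod I₂) (extChartAt (I₁.prod I₂) p).symm y =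
        (mfderiv 𝓘(ℝ, E₁) I₁ (extChartAt I₁ p.1).symm y.1).prodMap
          (mfderiv 𝓘(ℝ, E₂) I₂ (extChartAt I₂ p.2).symm y.2) := by
      rw [hsymm, modelWithCornersSelf_prod, ← chartedSpaceSelf_prod]
      exact mfderiv_prodMap d₁ d₂
    rw [PseudoRiemannianMetric.inChart_apply, hd, hsymm]
    simp only [doublyWarpedProduct, add_apply, smul_apply, pullback_apply, mfderiv_fst, mfderiv_snd,
      smul_eq_mul]
    rfl

/-- The covariant derivative of the Ricci tensor of a doubly warped product, on vectors tangent to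
the first factor. -/
theorem covDerivRicci_doublyWarpedProduct_fst [FiniteDimensional ℝ E₁] [FiniteDimensional ℝ E₂]
    (p₁ : M₁) (p₂ : M₂) (X Y Z : TangentSpace I₁ p₁) :
    (doublyWarpedProduct g₁ g₂ f₁ f₂ hf₁ hf₂ hpos₁ hpos₂).covDerivRicci (p₁, p₂)
        (show E₁ × E₂ from (X, 0)) (show E₁ × E₂ from (Y, 0)) (show E₁ × E₂ from (Z, 0)) =
      g₁.covDerivRicci p₁ X Y Z - g₁.covDerivF (Module.finrank ℝ E₂) f₁ p₁ X Y Z +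
        ((Module.finrank ℝ E₁ + Module.finrank ℝ E₂ : ℝ) - 2) / f₁ p₁ ^ 3 *
          (g₁.inner p₁ X Y * mvfderiv I₁ f₁ p₁ Z + g₁.inner p₁ X Z * mvfderiv I₁ f₁ p₁ Y) *
            mvfderiv I₂ f₂ p₂ (g₂.grad f₂ p₂) +
        2 * (g₂.diamond (Module.finrank ℝ E₁) f₂ p₂ / f₁ p₁ ^ 3) * mvfderiv I₁ f₁ p₁ X *
          g₁.inner p₁ Y Z := by
  have h := (isWarpedOn_inChart g₁ g₂ hf₁ hf₂ hpos₁ hpos₂ (p₁, p₂)).covDeriv_ricci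
    (x := (extChartAt I₁ p₁ p₁, extChartAt I₂ p₂ p₂)) (mem_extChartAt_target p₁)
    (mem_extChartAt_target p₂) X Y Z
  have e₁ : (f₁ ∘ (extChartAt I₁ p₁).symm) (extChartAt I₁ p₁ p₁) = f₁ p₁ :=
    congrArg f₁ (extChartAt_to_inv p₁)
  have e₂ : (f₂ ∘ (extChartAt I₂ p₂).symm) (extChartAt I₂ p₂ p₂) = f₂ p₂ :=
    congrArg f₂ (extChartAt_to_inv p₂)
  simp only [PseudoRiemannianMetric.covDerivRicci, PseudoRiemannianMetric.covDerivF,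
    PseudoRiemannianMetric.covDerivAt_eq]
  rw [PseudoRiemannianMetric.diamond, PseudoRiemannianMetric.laplacian, g₂.inner_grad hf₂,
    mvfderiv_eq_fderiv_comp_extChartAt_symm hf₁, mvfderiv_eq_fderiv_comp_extChartAt_symm hf₂,
    g₂.grad_eq hf₂, ← g₁.inChart_self, ← g₁.inChart_self, ← g₁.inChart_self, ← e₁, ← e₂]
  exact (PseudoRiemannianMetric.covDerivAt_eq _ (p₁, p₂) _ _ _ _).trans h

/-- The covariant derivative of the Ricci tensor of a doubly warped product, on vectors tangent to
the second factor. -/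
theorem covDerivRicci_doublyWarpedProduct_snd [FiniteDimensional ℝ E₁] [FiniteDimensional ℝ E₂]
    (p₁ : M₁) (p₂ : M₂) (X Y Z : TangentSpace I₂ p₂) :
    (doublyWarpedProduct g₁ g₂ f₁ f₂ hf₁ hf₂ hpos₁ hpos₂).covDerivRicci (p₁, p₂)
        (show E₁ × E₂ from (0, X)) (show E₁ × E₂ from (0, Y)) (show E₁ × E₂ from (0, Z)) =
      g₂.covDerivRicci p₂ X Y Z - g₂.covDerivF (Module.finrank ℝ E₁) f₂ p₂ X Y Z +
        ((Module.finrank ℝ E₂ + Module.finrank ℝ E₁ : ℝ) - 2) / f₂ p₂ ^ 3 *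
          (g₂.inner p₂ X Y * mvfderiv I₂ f₂ p₂ Z + g₂.inner p₂ X Z * mvfderiv I₂ f₂ p₂ Y) *
            mvfderiv I₁ f₁ p₁ (g₁.grad f₁ p₁) +
        2 * (g₁.diamond (Module.finrank ℝ E₂) f₁ p₁ / f₂ p₂ ^ 3) * mvfderiv I₂ f₂ p₂ X *
          g₂.inner p₂ Y Z := by
  -- Exchanging the summands turns the first-factor formula into the one needed here.
  have h := (isWarpedOn_inChart g₁ g₂ hf₁ hf₂ hpos₁ hpos₂ (p₁, p₂)).swap.covDeriv_ricci
    (x := (extChartAt I₁ p₁ p₁, extChartAt I₂ p₂ p₂)) (mem_extChartAt_target p₂)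
    (mem_extChartAt_target p₁) X Y Z
  have e₁ : (f₁ ∘ (extChartAt I₁ p₁).symm) (extChartAt I₁ p₁ p₁) = f₁ p₁ :=
    congrArg f₁ (extChartAt_to_inv p₁)
  have e₂ : (f₂ ∘ (extChartAt I₂ p₂).symm) (extChartAt I₂ p₂ p₂) = f₂ p₂ :=
    congrArg f₂ (extChartAt_to_inv p₂)
  simp only [PseudoRiemannianMetric.covDerivRicci, PseudoRiemannianMetric.covDerivF,
    PseudoRiemannianMetric.covDerivAt_eq]
  rw [PseudoRiemannianMetric.diamond, PseudoRiemannianMetric.laplacian, g₁.inner_grad hf₁,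
    mvfderiv_eq_fderiv_comp_extChartAt_symm hf₁, mvfderiv_eq_fderiv_comp_extChartAt_symm hf₂,
    g₁.grad_eq hf₁, ← g₂.inChart_self, ← g₂.inChart_self, ← g₂.inChart_self, ← e₁, ← e₂]
  exact (PseudoRiemannianMetric.covDerivAt_eq _ (p₁, p₂) _ _ _ _).trans h

end Product

end DoublyWarped

end

theorem mainTheorem3
    {E₁ : Type*} [NormedAddCommGroup E₁] [NormedSpace ℝ E₁] [FiniteDimensional ℝ E₁]
    {E₂ : Type*} [NormedAddCommGroup E₂] [NormedSpace ℝ E₂] [FiniteDimensional ℝ E₂]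
    {H₁ : Type*} [TopologicalSpace H₁] {H₂ : Type*} [TopologicalSpace H₂]
    {I₁ : ModelWithCorners ℝ E₁ H₁} [I₁.Boundaryless]
    {I₂ : ModelWithCorners ℝ E₂ H₂} [I₂.Boundaryless]
    {M₁ : Type*} [TopologicalSpace M₁] [ChartedSpace H₁ M₁] [IsManifold I₁ ∞ M₁] [Nonempty M₁]
    {M₂ : Type*} [TopologicalSpace M₂] [ChartedSpace H₂ M₂] [IsManifold I₂ ∞ M₂] [Nonempty M₂]
    (g₁ : DoublyWarped.PseudoRiemannianMetric I₁ M₁)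
    (g₂ : DoublyWarped.PseudoRiemannianMetric I₂ M₂)
    (f₁ : M₁ → ℝ) (f₂ : M₂ → ℝ)
    (hf₁ : ContMDiff I₁ 𝓘(ℝ) ∞ f₁) (hf₂ : ContMDiff I₂ 𝓘(ℝ) ∞ f₂)
    (hpos₁ : ∀ p, 0 < f₁ p) (hpos₂ : ∀ p, 0 < f₂ p)
    (n₁ n₂ n : ℕ) (hn₁ : n₁ = Module.finrank ℝ E₁) (hn₂ : n₂ = Module.finrank ℝ E₂)
    (hn : n = n₁ + n₂)
    (hM : (DoublyWarped.doublyWarpedProduct g₁ g₂ f₁ f₂ hf₁ hf₂ hpos₁ hpos₂).IsRicciSymmetric) :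
    (g₁.IsRicciSymmetric ↔
      ∀ (p₁ : M₁) (p₂ : M₂) (X Y Z : TangentSpace I₁ p₁),
        g₁.covDerivF n₂ f₁ p₁ X Y Z =
          ((n : ℝ) - 2) / f₁ p₁ ^ 3 *
              (g₁.inner p₁ X Y * mvfderiv I₁ f₁ p₁ Z + g₁.inner p₁ X Z * mvfderiv I₁ f₁ p₁ Y) *
              mvfderiv I₂ f₂ p₂ (g₂.grad f₂ p₂)
            + 2 * (g₂.diamond n₁ f₂ p₂ / f₁ p₁ ^ 3) * mvfderiv I₁ f₁ p₁ X * g₁.inner p₁ Y Z) ∧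
    (g₂.IsRicciSymmetric ↔
      ∀ (p₁ : M₁) (p₂ : M₂) (X Y Z : TangentSpace I₂ p₂),
        g₂.covDerivF n₁ f₂ p₂ X Y Z =
          ((n : ℝ) - 2) / f₂ p₂ ^ 3 *
              (g₂.inner p₂ X Y * mvfderiv I₂ f₂ p₂ Z + g₂.inner p₂ X Z * mvfderiv I₂ f₂ p₂ Y) *
              mvfderiv I₁ f₁ p₁ (g₁.grad f₁ p₁)
            + 2 * (g₁.diamond n₂ f₁ p₁ / f₂ p₂ ^ 3) * mvfderiv I₂ f₂ p₂ X * g₂.inner p₂ Y Z) := by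
  subst hn hn₁ hn₂
  refine ⟨⟨fun hR p₁ p₂ X Y Z ↦ ?_, fun hF p₁ X Y Z ↦ ?_⟩,
    ⟨fun hR p₁ p₂ X Y Z ↦ ?_, fun hF p₂ X Y Z ↦ ?_⟩⟩
  · have h := (DoublyWarped.covDerivRicci_doublyWarpedProduct_fst g₁ g₂ hf₁ hf₂ hpos₁ hpos₂
      p₁ p₂ X Y Z).symm.trans (hM _ _ _ _)
    rw [hR p₁ X Y Z] at h
    push_cast
    linarith
  -- `(D¹_X Ric₁)(Y, Z)` does not involve `p₂`, so a single point of the other factor suffices, but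
  -- one must exist.
  · obtain ⟨p₂⟩ := ‹Nonempty M₂›
    have h := (DoublyWarped.covDerivRicci_doublyWarpedProduct_fst g₁ g₂ hf₁ hf₂ hpos₁ hpos₂
      p₁ p₂ X Y Z).symm.trans (hM _ _ _ _)
    have h' := hF p₁ p₂ X Y Z
    push_cast at h'
    linarith
  · have h := (DoublyWarped.covDerivRicci_doublyWarpedProduct_snd g₁ g₂ hf₁ hf₂ hpos₁ hpos₂
      p₁ p₂ X Y Z).symm.trans (hM _ _ _ _)
    rw [hR p₂ X Y Z] at h
    push_cast
    rw [add_comm (Module.finrank ℝ E₁ : ℝ)]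
    linarith
  · obtain ⟨p₁⟩ := ‹Nonempty M₁›
    have h := (DoublyWarped.covDerivRicci_doublyWarpedProduct_snd g₁ g₂ hf₁ hf₂ hpos₁ hpos₂
      p₁ p₂ X Y Z).symm.trans (hM _ _ _ _)
    have h' := hF p₁ p₂ X Y Z
    push_cast at h'
    rw [add_comm (Module.finrank ℝ E₁ : ℝ)] at h'
    linarith
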